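/- For permutations $\sigma=\sigma_1\cdots\sigma_n$ of $\{1,\dots,n\}$ and $\tau=\tau_1\cdots\tau_k$ of $\{1,\dots,k\}$, let $f(\sigma,\tau)$ be the number of copies of $\tau$ in $\sigma$, that is, the number of index sequences $s_1<\cdots<s_k$ such that $\sigma_{s_1}\cdots\sigma_{s_k}$ is in the same relative order as $\tau_1\cdots\tau_k$. Let $S_n(132)$ be the set of permutations $\sigma$ of $\{1,\dots,n\}$ with $f(\sigma,132)=0$, and let $A_n(\tau)=\sum_{\sigma\in S_n(132)}f(\sigma,\tau)$. For $\tau\in S_k(132)$ and $1\le j\le k$, we say that $\tau^{\tau_j}$ is defined if there is an index $i<j$ such that $\tau_i<\tau_j$, $\tau_\alpha>\tau_j$ for all $\alpha<i$, and $\tau_\beta<\tau_i$ for all $i<\beta<j$. Such an $i$ is unique, and $\tau^{\tau_j}$ is then the permutation $$\tau_1\cdots\tau_{i-1}\,\tau_j\,\tau_i\,\tau_{i+1}\cdots\tau_{j-1}\,\tau_{j+1}\cdots\tau_k$$ obtained from $\tau$ by removing $\tau_j$ and inserting it immediately before $\tau_i$. Theorem. Suppose that $\tau\in S_k(132)$ and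 that $\mu=\tau^{\tau_j}$ is defined for some $j$. Then $A_n(\mu)>A_n(\tau)$ for every integer $n>k$. -/

import Mathlib

namespace PatternPopularity

/-- The strictly increasing sequence of positions `e 0 < ⋯ < e (k-1)` is an occurrence of the
pattern `τ` in `σ`: the entries of `σ` in these positions are in the same relative order as the
entries of `τ`. A permutation of `{1, …, n}` in one-line notation `σ₁ ⋯ σₙ` is represented by
`σ : Equiv.Perm (Fin n)`, both positions and values being shifted to `0, …, n - 1`. -/
def IsOccurrence {n k : ℕ} (σ : Equiv.Perm (Fin n)) (τ : Equiv.Perm (Fin k))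
    (e : Fin k ↪o Fin n) : Prop :=
  ∀ s t : Fin k, σ (e s) ≤ σ (e t) ↔ τ s ≤ τ t

/-- `σ` contains the pattern `τ`. -/
def Contains {n k : ℕ} (σ : Equiv.Perm (Fin n)) (τ : Equiv.Perm (Fin k)) : Prop :=
  ∃ e : Fin k ↪o Fin n, IsOccurrence σ τ e

/-- The pattern `132`; with values shifted to start at `0` it is `0 ↦ 0, 1 ↦ 2, 2 ↦ 1`. -/
def pattern132 : Equiv.Perm (Fin 3) := Equiv.swap 1 2

/-- `σ` is `132`-avoiding, that is, `σ ∈ Sₙ(132)`. -/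
def Avoids132 {n : ℕ} (σ : Equiv.Perm (Fin n)) : Prop :=
  ¬ Contains σ pattern132

/-- The number `f(σ, τ)` of copies of `τ` in `σ`. -/
noncomputable def copies {n k : ℕ} (σ : Equiv.Perm (Fin n)) (τ : Equiv.Perm (Fin k)) : ℕ :=
  Nat.card {e : Fin k ↪o Fin n // IsOccurrence σ τ e}

open Classical in
/-- The popularity `Aₙ(τ)`: the sum of `f(σ, τ)` over all `σ ∈ Sₙ(132)`. -/
noncomputable def popularity (n : ℕ) {k : ℕ} (τ : Equiv.Perm (Fin k)) : ℕ :=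
  ∑ σ : Equiv.Perm (Fin n) with Avoids132 σ, copies σ τ

/-- The conditions on a pair of positions `i < j` under which `σ_j` may be moved to the place
just before `σ_i`. -/
structure Movable {n : ℕ} (σ : Equiv.Perm (Fin n)) (i j : Fin n) : Prop where
  lt : i < j
  val_lt : σ i < σ j
  left : ∀ a, a < i → σ j < σ a
  middle : ∀ b, i < b → b < j → σ b < σ i

/-- `φ` is obtained from `σ` by removing `σ_j` and inserting it before `σ_i`:
`φ = σ_1 ⋯ σ_{i-1} σ_j σ_i ⋯ σ_{j-1} σ_{j+1} ⋯ σ_n`. -/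
structure IsMoved {n : ℕ} (σ : Equiv.Perm (Fin n)) (i j : Fin n) (φ : Equiv.Perm (Fin n)) :
    Prop where
  before : ∀ a, a < i → φ a = σ a
  at_i : φ i = σ j
  shifted : ∀ a b : Fin n, i ≤ a → b ≤ j → (b : ℕ) = a + 1 → φ b = σ a
  after : ∀ a, j < a → φ a = σ a

/-- `σ^{σ_j}` is defined and equal to `φ`. -/
def IsPower {n : ℕ} (σ : Equiv.Perm (Fin n)) (j : Fin n) (φ : Equiv.Perm (Fin n)) : Prop :=
  ∃ i : Fin n, Movable σ i j ∧ IsMoved σ i j φ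

end PatternPopularity

/-! Cutting a `132`-avoiding word at its maximum, as `q M t`, forces every entry of `q` above every
entry of `t`. Iterating gives a bijection with binary trees, under which a subsequence is a copy of
a pattern exactly when it has the pattern's tree. Hence the popularity of a pattern with tree `F` is
a coefficient of `copyGF F`.

A copy in `q M t` that avoids `M` cuts the right spine of `F` into a part in `q` and a part in `t`;
a copy that uses `M` puts the root of `F` there. The resulting recurrence is solved by a product
(`copyGF_eq`): with `S m = spineGF m`, `copyGF F` is `S` of the right spine length of `F`, times a
factor `X * S m` for each node whose left subtree has right spine length `m`.

Passing from `τ` to `μ` takes a node with nonempty left subtree `a` and right subtree `b`, and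
appends the spine of `b` to that of `a` to form the new right subtree (`IsWord.exists_move`). Only
two spine lengths change, so the theorem reduces to comparing `S 0 * S (m + r)` with `S m * S r` for
positive `m`, `r`. The recurrence for `S` shows by induction that the difference has nonnegative
coefficients, and positive ones from degree 1 on (`posFrom_spineGF_sub`). Each node contributes a
further factor `X`, so strictness begins at degree `k + 1`. -/

namespace PatternPopularity

/-! ### Binary trees of `132`-avoiding words -/

open BinaryTree

variable {α β : Type*} [LinearOrder α] [LinearOrder β]

/-- `IsWord F l` says that the list `l` is `132`-avoiding with decreasing decomposition given by the
binary tree `F`: a nonempty word is `q ++ M :: t` with `M` the maximum and every entry of `q` larger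
than every entry of `t`; the subtrees of the root are the trees of `q` and `t`. -/
def IsWord : BinaryTree Unit → List α → Prop
  | .nil, l => l = []
  | .node _ a b, l => ∃ q M t, l = q ++ M :: t ∧ IsWord a q ∧ IsWord b t ∧
      (∀ x ∈ q, x < M) ∧ (∀ y ∈ t, y < M) ∧ ∀ x ∈ q, ∀ y ∈ t, y < x

/-- Two decompositions of a list at its strict maximum agree. -/
theorem append_cons_max_inj {q q' t t' : List α} {M M' : α} (h : q ++ M :: t = q' ++ M' :: t')
    (hq : ∀ x ∈ q, x < M) (ht : ∀ x ∈ t, x < M) (hq' : ∀ x ∈ q', x < M')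
    (ht' : ∀ x ∈ t', x < M') : q = q' ∧ M = M' ∧ t = t' := by
  rw [List.append_eq_append_iff] at h
  rcases h with ⟨e, rfl, h⟩ | ⟨e, rfl, h⟩ <;> cases e with
  | nil => simp_all
  | cons c e =>
    simp only [List.cons_append, List.cons.injEq] at h
    obtain ⟨rfl, rfl⟩ := h
    simp only [List.mem_append, List.mem_cons] at *
    first
    | exact absurd (lt_trans (hq' M (by tauto)) (ht M' (by tauto))) (lt_irrefl _)
    | exact absurd (lt_trans (hq M' (by tauto)) (ht' M (by tauto))) (lt_irrefl _)

theorem isWord_node_iff {a b : BinaryTree Unit} {u : Unit} {q t : List α} {M : α}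
    (hq : ∀ x ∈ q, x < M) (ht : ∀ x ∈ t, x < M) :
    IsWord (.node u a b) (q ++ M :: t) ↔
      IsWord a q ∧ IsWord b t ∧ ∀ x ∈ q, ∀ y ∈ t, y < x := by
  constructor
  · rintro ⟨q', M', t', h, ha, hb, hq', ht', hqt⟩
    obtain ⟨rfl, rfl, rfl⟩ := append_cons_max_inj h hq ht hq' ht'
    exact ⟨ha, hb, hqt⟩
  · rintro ⟨ha, hb, hqt⟩
    exact ⟨q, M, t, rfl, ha, hb, hq, ht, hqt⟩

theorem IsWord.length_eq {F : BinaryTree Unit} {l : List α} (h : IsWord F l) :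
    l.length = F.numNodes := by
  induction F generalizing l with
  | nil => simp_all [IsWord]
  | node u a b iha ihb =>
    obtain ⟨q, M, t, rfl, ha, hb, -⟩ := h
    simp [iha ha, ihb hb]
    omega

theorem IsWord.nodup {F : BinaryTree Unit} {l : List α} (h : IsWord F l) : l.Nodup := by
  induction F generalizing l with
  | nil => simp_all [IsWord]
  | node u a b iha ihb =>
    obtain ⟨q, M, t, rfl, ha, hb, hq, ht, hqt⟩ := h
    simp only [List.nodup_append, List.nodup_cons, List.mem_cons]
    refine ⟨iha ha, ⟨fun h => lt_irrefl _ (ht _ h), ihb hb⟩, ?_⟩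
    rintro x hx y (rfl | hy)
    · exact (hq x hx).ne
    · exact (hqt x hx y hy).ne'

theorem IsWord.tree_unique {F G : BinaryTree Unit} {l : List α} (hF : IsWord F l)
    (hG : IsWord G l) : F = G := by
  induction F generalizing G l with
  | nil =>
    cases G with
    | nil => rfl
    | node => obtain ⟨q, M, t, rfl, -⟩ := hG; simp [IsWord] at hF
  | node u a b iha ihb =>
    obtain ⟨q, M, t, rfl, ha, hb, hq, ht, hqt⟩ := hF
    cases G with
    | nil => simp [IsWord] at hG
    | node v c d =>
      obtain ⟨hc, hd, -⟩ := (isWord_node_iff hq ht).1 hG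
      rw [iha ha hc, ihb hb hd]

/-- Entries of a list of pairs compare in the same way in both coordinates. -/
def SameOrder (z w : α × β) : Prop :=
  (z.1 < w.1 ↔ z.2 < w.2) ∧ (w.1 < z.1 ↔ w.2 < z.2)

theorem IsWord.of_sameOrder {F : BinaryTree Unit} {z : List (α × β)}
    (hz : z.Pairwise SameOrder) (h : IsWord F (z.map Prod.fst)) : IsWord F (z.map Prod.snd) := by
  induction F generalizing z with
  | nil => simpa [IsWord] using h
  | node u a b iha ihb =>
    obtain ⟨q, M, t, he, ha, hb, hq, ht, hqt⟩ := h
    obtain ⟨zq, zr, rfl, rfl, hr⟩ := List.map_eq_append_iff.1 he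
    obtain ⟨m, zt, rfl, rfl, rfl⟩ := List.map_eq_cons_iff.1 hr
    simp only [List.pairwise_append, List.pairwise_cons, List.mem_cons] at hz
    obtain ⟨h1, ⟨h2, h3⟩, h4⟩ := hz
    refine ⟨zq.map Prod.snd, m.2, zt.map Prod.snd, by simp, iha h1 ha, ihb h3 hb, ?_, ?_, ?_⟩
    · simp only [List.forall_mem_map] at hq ⊢
      exact fun x hx => (h4 x hx m (Or.inl rfl)).1.1 (hq x hx)
    · simp only [List.forall_mem_map] at ht ⊢
      exact fun x hx => (h2 x hx).2.1 (ht x hx)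
    · simp only [List.forall_mem_map] at hqt ⊢
      exact fun x hx y hy => (h4 x hx y (Or.inr hy)).2.1 (hqt x hx y hy)

theorem IsWord.sameOrder {F : BinaryTree Unit} {z : List (α × β)}
    (h : IsWord F (z.map Prod.fst)) (h' : IsWord F (z.map Prod.snd)) :
    z.Pairwise SameOrder := by
  induction F generalizing z with
  | nil => simp_all [IsWord]
  | node u a b iha ihb =>
    obtain ⟨q, M, t, he, ha, hb, hq, ht, hqt⟩ := h
    obtain ⟨q', M', t', he', ha', hb', hq', ht', hqt'⟩ := h'
    obtain ⟨zq, zr, rfl, rfl, hr⟩ := List.map_eq_append_iff.1 he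
    obtain ⟨m, zt, rfl, rfl, rfl⟩ := List.map_eq_cons_iff.1 hr
    have hl : (zq.map Prod.snd).length = q'.length := by
      rw [ha'.length_eq, ← ha.length_eq]; simp
    rw [List.map_append] at he'
    obtain ⟨rfl, h2⟩ := List.append_inj he' hl
    simp only [List.map_cons, List.cons.injEq] at h2
    obtain ⟨rfl, rfl⟩ := h2
    simp only [List.forall_mem_map] at *
    simp only [List.pairwise_append, List.pairwise_cons, List.mem_cons]
    refine ⟨iha ha ha', ⟨fun x hx => ?_, ihb hb hb'⟩, ?_⟩
    · exact ⟨iff_of_false (ht x hx).not_gt (ht' x hx).not_gt, iff_of_true (ht x hx) (ht' x hx)⟩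
    · rintro x hx y (rfl | hy)
      · exact ⟨iff_of_true (hq x hx) (hq' x hx), iff_of_false (hq x hx).not_gt (hq' x hx).not_gt⟩
      · exact ⟨iff_of_false (hqt x hx y hy).not_gt (hqt' x hx y hy).not_gt,
          iff_of_true (hqt x hx y hy) (hqt' x hx y hy)⟩

/-- No three entries of the list form the pattern `132`. -/
def ListAvoids (l : List α) : Prop :=
  l.Triplewise fun a b c => ¬ (a < c ∧ c < b)

theorem IsWord.listAvoids {F : BinaryTree Unit} {l : List α} (h : IsWord F l) : ListAvoids l := by
  induction F generalizing l with
  | nil => simp_all [IsWord, ListAvoids]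
  | node u a b iha ihb =>
    obtain ⟨q, M, t, rfl, ha, hb, hq, ht, hqt⟩ := h
    refine List.triplewise_append.2 ⟨iha ha, List.triplewise_cons.2 ⟨?_, ihb hb⟩, ?_, ?_⟩
    · exact List.pairwise_of_forall_mem_list fun x hx y hy h => (ht y hy).not_gt h.1
    · refine fun x hx => List.pairwise_cons.2 ⟨fun y hy h => (hqt x hx y hy).not_gt h.1, ?_⟩
      exact List.pairwise_of_forall_mem_list fun y hy w hw h => (hqt x hx w hw).not_gt h.1
    · intro y hy
      refine List.pairwise_of_forall_mem_list fun x hx w hw h => ?_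
      rcases List.mem_cons.1 hy with rfl | hy
      · exact (hq w hw).not_gt h.2
      · exact (hqt x hx y hy).not_gt h.1

/-- An entry before the maximum that is smaller than one after it would form a `132` with the
maximum in the middle. -/
theorem ListAvoids.exists_isWord {l : List α} (h : ListAvoids l) (hl : l.Nodup) :
    ∃ F, IsWord F l := by
  induction hn : l.length using Nat.strong_induction_on generalizing l with
  | _ n ih =>
    by_cases h0 : l = []
    · exact ⟨.nil, h0⟩
    obtain ⟨M, hM, hmax⟩ : ∃ M ∈ l, ∀ x ∈ l, x ≤ M := by
      obtain ⟨M, hM, h⟩ := l.toFinset.exists_max_image id (by simpa using h0)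
      exact ⟨M, by simpa using hM, by simpa using h⟩
    obtain ⟨q, t, rfl⟩ := List.append_of_mem hM
    obtain ⟨h1, h2, h3, h4⟩ := List.triplewise_append.1 h
    obtain ⟨n1, n2, n3⟩ := List.nodup_append.1 hl
    rw [List.nodup_cons] at n2
    simp only [List.length_append, List.length_cons] at hn
    have h5 : ListAvoids t := (List.triplewise_cons.1 h2).2
    obtain ⟨a, ha⟩ := ih q.length (by omega) h1 n1 rfl
    obtain ⟨b, hb⟩ := ih t.length (by omega) h5 n2.2 rfl
    have ht : ∀ y ∈ t, y < M := fun y hy =>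
      lt_of_le_of_ne (hmax y (by simp [hy])) fun e => n2.1 (e ▸ hy)
    refine ⟨.node () a b, q, M, t, rfl, ha, hb, fun x hx => ?_, ht, fun x hx y hy => ?_⟩
    · exact lt_of_le_of_ne (hmax x (by simp [hx])) (n3 x hx M (by simp))
    · have := (List.pairwise_cons.1 (h3 x hx)).1 y hy
      exact lt_of_le_of_ne (not_lt.1 fun h => this ⟨h, ht y hy⟩) (n3 x hx y (by simp [hy])).symm

/-- Join two trees along the right spine: the tree of a skew sum. -/
def join : BinaryTree Unit → BinaryTree Unit → BinaryTree Unit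
  | .nil, G => G
  | .node u a b, G => .node u a (join b G)

theorem IsWord.join {F G : BinaryTree Unit} {x y : List α} (hF : IsWord F x) (hG : IsWord G y)
    (hxy : ∀ c ∈ x, ∀ d ∈ y, d < c) : IsWord (join F G) (x ++ y) := by
  induction F generalizing x with
  | nil => simp_all [IsWord, PatternPopularity.join]
  | node u a b iha ihb =>
    obtain ⟨q, M, t, rfl, ha, hb, hq, ht, hqt⟩ := hF
    simp only [List.mem_append, List.mem_cons] at hxy
    refine ⟨q, M, t ++ y, by simp, ha, ihb hb fun c hc => hxy c (by tauto), hq, ?_, ?_⟩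
    · intro d hd
      rcases List.mem_append.1 hd with hd | hd
      · exact ht d hd
      · exact hxy M (by tauto) d hd
    · intro c hc d hd
      rcases List.mem_append.1 hd with hd | hd
      · exact hqt c hc d hd
      · exact hxy c (by tauto) d hd

/-! ### Counting copies on trees -/

/-- All ways of writing a tree as `join F₁ F₂`. -/
def splits : BinaryTree Unit → List (BinaryTree Unit × BinaryTree Unit)
  | .nil => [(.nil, .nil)]
  | .node u a b => (.nil, .node u a b) :: (splits b).map fun p => (.node u a p.1, p.2)

open Classical in
/-- The indicator function of `IsWord F`. -/
noncomputable def wordInd (F : BinaryTree Unit) (l : List α) : ℕ := if IsWord F l then 1 else 0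

theorem wordInd_node_append {u : Unit} {a b : BinaryTree Unit} {q t : List α} {M : α}
    (hq : ∀ x ∈ q, x < M) (ht : ∀ x ∈ t, x < M) (hqt : ∀ x ∈ q, ∀ y ∈ t, y < x) :
    wordInd (.node u a b) (q ++ M :: t) = wordInd a q * wordInd b t := by
  have h : IsWord (.node u a b) (q ++ M :: t) ↔ IsWord a q ∧ IsWord b t :=
    (isWord_node_iff hq ht).trans ⟨fun h => ⟨h.1, h.2.1⟩, fun h => ⟨h.1, h.2, hqt⟩⟩
  by_cases h1 : IsWord a q <;> by_cases h2 : IsWord b t <;> simp [wordInd, h, h1, h2]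

theorem wordInd_nil_append (x y : List α) :
    wordInd .nil (x ++ y) = wordInd .nil x * wordInd .nil y := by
  by_cases h1 : x = [] <;> by_cases h2 : y = [] <;> simp [wordInd, IsWord, h1, h2]

theorem wordInd_nil_append_cons (x y : List α) (M : α) :
    wordInd .nil (x ++ M :: y) = 0 := by
  simp [wordInd, IsWord]

/-- The maximum of a nonempty `x` is also that of `x ++ y`, so removing it peels one node off the
right spine. At most one split contributes, because a word determines its tree. -/
theorem wordInd_append {F : BinaryTree Unit} {x y : List α} (hx : x.Nodup)
    (hxy : ∀ c ∈ x, ∀ d ∈ y, d < c) :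
    wordInd F (x ++ y) = ((splits F).map fun p => wordInd p.1 x * wordInd p.2 y).sum := by
  induction F generalizing x with
  | nil => simp [splits, wordInd_nil_append]
  | node u a b iha ihb =>
    simp only [splits, List.map_cons, List.map_map, List.sum_cons]
    by_cases h0 : x = []
    · subst h0
      have h1 : ∀ p : BinaryTree Unit × BinaryTree Unit,
          wordInd (.node u a p.1) ([] : List α) = 0 := by simp [wordInd, IsWord]
      have h2 : wordInd .nil ([] : List α) = 1 := by simp [wordInd, IsWord]
      simp [Function.comp_def, h1, h2]
    obtain ⟨M, hM, hmax⟩ : ∃ M ∈ x, ∀ c ∈ x, c ≤ M := by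
      obtain ⟨M, hM, h⟩ := x.toFinset.exists_max_image id (by simpa using h0)
      exact ⟨M, by simpa using hM, by simpa using h⟩
    obtain ⟨q, t, rfl⟩ := List.append_of_mem hM
    obtain ⟨n1, n2, n3⟩ := List.nodup_append.1 hx
    rw [List.nodup_cons] at n2
    have hq : ∀ c ∈ q, c < M := fun c hc =>
      lt_of_le_of_ne (hmax c (by simp [hc])) (n3 c hc M (by simp))
    have ht : ∀ c ∈ t, c < M := fun c hc =>
      lt_of_le_of_ne (hmax c (by simp [hc])) fun e => n2.1 (e ▸ hc)
    have hty : ∀ c ∈ t ++ y, c < M := by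
      intro c hc
      rcases List.mem_append.1 hc with hc | hc
      · exact ht c hc
      · exact hxy M hM c hc
    have h2 : wordInd .nil (q ++ M :: t) = 0 := wordInd_nil_append_cons ..
    rw [h2, zero_mul, zero_add, List.append_assoc, List.cons_append]
    by_cases hqt : ∀ c ∈ q, ∀ d ∈ t, d < c
    · have hqty : ∀ c ∈ q, ∀ d ∈ t ++ y, d < c := by
        intro c hc d hd
        rcases List.mem_append.1 hd with hd | hd
        · exact hqt c hc d hd
        · exact hxy c (by simp [hc]) d hd
      rw [wordInd_node_append hq hty hqty, ihb n2.2 fun c hc => hxy c (by simp [hc]),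
        ← List.sum_map_mul_left]
      simp [Function.comp_def, wordInd_node_append hq ht hqt, mul_assoc]
    -- Here `x` itself has no tree, so both sides vanish.
    · have h3 : ∀ c, ¬ IsWord (.node u a c) (q ++ M :: t) := fun c hc =>
        hqt ((isWord_node_iff hq ht).1 hc).2.2
      have h4 : ¬ IsWord (.node u a b) (q ++ M :: (t ++ y)) := fun hc =>
        hqt fun c hc' d hd => ((isWord_node_iff hq hty).1 hc).2.2 c hc' d (by simp [hd])
      simp [Function.comp_def, wordInd, h3, h4]

/-- The number of sublists of `l` (with multiplicity) with tree `F`. -/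
noncomputable def countWords (F : BinaryTree Unit) (l : List α) : ℕ :=
  (l.sublists.map (wordInd F)).sum

/-- The contribution to `treeCount` of the copies using the root. -/
def treeCountRoot (f g : BinaryTree Unit → ℕ) : BinaryTree Unit → ℕ
  | .nil => 0
  | .node _ a b => f a * g b

/-- The number of copies of the tree `F` in the tree `G`; see `countWords_eq_treeCount`. -/
def treeCount : BinaryTree Unit → BinaryTree Unit → ℕ
  | .nil, F => if F = .nil then 1 else 0
  | .node _ a b, F => ((splits F).map fun p => treeCount a p.1 * treeCount b p.2).sum +
      treeCountRoot (treeCount a) (treeCount b) F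

theorem sum_map_sublists_append_cons {γ : Type*} (f : List γ → ℕ) (q t : List γ) (M : γ) :
    ((q ++ M :: t).sublists.map f).sum =
      (t.sublists.map fun y => (q.sublists.map fun x => f (x ++ y)).sum).sum +
      (t.sublists.map fun y => (q.sublists.map fun x => f (x ++ M :: y)).sum).sum := by
  rw [List.sublists_append, List.sublists_cons]
  induction t.sublists with
  | nil => simp
  | cons y L ih =>
    simp only [List.bind_eq_flatMap, List.flatMap_cons, List.cons_append, List.nil_append,
      List.map_append, List.map_map, List.sum_append, List.map_cons, List.sum_cons,
      Function.comp_def] at ih ⊢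
    rw [ih]
    ring

theorem sum_map_sum_map_mul {ι κ κ' : Type*} (S : List ι) (L : List κ) (L' : List κ')
    (g : ι → κ → ℕ) (h : ι → κ' → ℕ) :
    (L'.map fun y => (L.map fun x => (S.map fun p => g p x * h p y).sum).sum).sum =
      (S.map fun p => (L.map (g p)).sum * (L'.map (h p)).sum).sum := by
  induction S with
  | nil => simp
  | cons p S ih =>
    simp only [List.map_cons, List.sum_cons, List.sum_map_add, ih, List.sum_map_mul_right,
      List.sum_map_mul_left]

/-- A sublist of `q ++ M :: t` either omits `M`, and is then a skew sum of sublists of `q` and `t`,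
or contains `M` as its maximum. -/
theorem countWords_eq_treeCount {G : BinaryTree Unit} {l : List α} (h : IsWord G l)
    (F : BinaryTree Unit) : countWords F l = treeCount G F := by
  induction G generalizing l F with
  | nil =>
    obtain rfl : l = [] := h
    cases F <;> simp [countWords, wordInd, IsWord, treeCount]
  | node u a b iha ihb =>
    obtain ⟨q, M, t, rfl, ha, hb, hq, ht, hqt⟩ := h
    rw [countWords, sum_map_sublists_append_cons, treeCount]
    have hsub : ∀ y ∈ t.sublists, ∀ x ∈ q.sublists, ∀ c ∈ x, ∀ d ∈ y, d < c :=
      fun y hy x hx c hc d hd => hqt c ((List.mem_sublists.1 hx).subset hc) d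
        ((List.mem_sublists.1 hy).subset hd)
    congr 1
    · simp only [← iha ha, ← ihb hb, countWords, ← sum_map_sum_map_mul]
      refine congrArg List.sum (List.map_congr_left fun y hy => ?_)
      refine congrArg List.sum (List.map_congr_left fun x hx => ?_)
      exact wordInd_append (ha.nodup.sublist (List.mem_sublists.1 hx)) (hsub y hy x hx)
    · cases F with
      | nil => simp [treeCountRoot, wordInd_nil_append_cons]
      | node v c d =>
        simp only [treeCountRoot, ← iha ha, ← ihb hb, countWords, ← List.sum_map_mul_left,
          ← List.sum_map_mul_right]
        refine congrArg List.sum (List.map_congr_left fun y hy => ?_)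
        refine congrArg List.sum (List.map_congr_left fun x hx => ?_)
        exact wordInd_node_append (fun c hc => hq c ((List.mem_sublists.1 hx).subset hc))
          (fun d hd => ht d ((List.mem_sublists.1 hy).subset hd)) (hsub y hy x hx)

end PatternPopularity

/-! ### Positivity of power series -/

namespace PatternPopularity

open BinaryTree PowerSeries Finset

/-- All coefficients are nonnegative. -/
def NonnegCoeff (f : ℤ⟦X⟧) : Prop := ∀ n, 0 ≤ coeff n f

/-- All coefficients are positive. -/
def PosCoeff (f : ℤ⟦X⟧) : Prop := ∀ n, 0 < coeff n f

theorem PosCoeff.nonneg {f : ℤ⟦X⟧} (h : PosCoeff f) : NonnegCoeff f := fun n => (h n).le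

theorem NonnegCoeff.add {f g : ℤ⟦X⟧} (hf : NonnegCoeff f) (hg : NonnegCoeff g) :
    NonnegCoeff (f + g) := fun n => by
  rw [map_add]; exact add_nonneg (hf n) (hg n)

theorem NonnegCoeff.mul {f g : ℤ⟦X⟧} (hf : NonnegCoeff f) (hg : NonnegCoeff g) :
    NonnegCoeff (f * g) := fun n => by
  rw [coeff_mul]; exact sum_nonneg fun p _ => mul_nonneg (hf _) (hg _)

theorem NonnegCoeff.sum {ι : Type*} {s : Finset ι} {f : ι → ℤ⟦X⟧}
    (hf : ∀ i ∈ s, NonnegCoeff (f i)) : NonnegCoeff (∑ i ∈ s, f i) := fun n => by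
  rw [map_sum]; exact sum_nonneg fun i hi => hf i hi n

theorem nonnegCoeff_X : NonnegCoeff X := fun n => by
  rw [coeff_X]; split_ifs <;> simp

theorem PosCoeff.mul {f g : ℤ⟦X⟧} (hf : PosCoeff f) (hg : PosCoeff g) : PosCoeff (f * g) :=
  fun n => by
    rw [coeff_mul]
    exact sum_pos (fun p _ => mul_pos (hf _) (hg _)) ⟨(0, n), by simp⟩

theorem NonnegCoeff.add_pos {f g : ℤ⟦X⟧} (hf : NonnegCoeff f) (hg : PosCoeff g) :
    PosCoeff (f + g) := fun n => by
  rw [map_add]; exact add_pos_of_nonneg_of_pos (hf n) (hg n)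

/-- `f` is `X ^ d` times a series with positive coefficients. -/
def PosFrom (d : ℕ) (f : ℤ⟦X⟧) : Prop := ∃ h, PosCoeff h ∧ f = X ^ d * h

/-- `f` is `X ^ d` times a series with nonnegative coefficients and positive constant term. -/
def NonnegFrom (d : ℕ) (f : ℤ⟦X⟧) : Prop := ∃ h, (NonnegCoeff h ∧ 0 < coeff 0 h) ∧ f = X ^ d * h

/-- Pairing each coefficient of the first factor with the constant term of the second already gives
a positive term. The weaker class is needed because it contains `nodeGF .nil = 1`. -/
theorem PosFrom.mul {d e : ℕ} {f g : ℤ⟦X⟧} (hf : PosFrom d f) (hg : NonnegFrom e g) :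
    PosFrom (d + e) (f * g) := by
  obtain ⟨f, hf, rfl⟩ := hf
  obtain ⟨g, ⟨hg, hg0⟩, rfl⟩ := hg
  refine ⟨f * g, fun n => ?_, by ring⟩
  rw [coeff_mul]
  exact sum_pos' (fun p _ => mul_nonneg (hf _).le (hg _)) ⟨(n, 0), by simp, mul_pos (hf n) hg0⟩

theorem NonnegFrom.mul {d e : ℕ} {f g : ℤ⟦X⟧} (hf : NonnegFrom d f) (hg : NonnegFrom e g) :
    NonnegFrom (d + e) (f * g) := by
  obtain ⟨f, ⟨hf, hf0⟩, rfl⟩ := hf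
  obtain ⟨g, ⟨hg, hg0⟩, rfl⟩ := hg
  refine ⟨f * g, ⟨hf.mul hg, ?_⟩, by ring⟩
  rw [coeff_mul]
  simpa using mul_pos hf0 hg0

theorem PosCoeff.nonnegFrom {f : ℤ⟦X⟧} (hf : PosCoeff f) : NonnegFrom 0 f :=
  ⟨f, ⟨hf.nonneg, hf 0⟩, by simp⟩

theorem NonnegFrom.X_mul {d : ℕ} {f : ℤ⟦X⟧} (hf : NonnegFrom d f) :
    NonnegFrom (d + 1) (X * f) := by
  obtain ⟨f, hf, rfl⟩ := hf
  exact ⟨f, hf, by ring⟩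

theorem PosFrom.X_mul {d : ℕ} {f : ℤ⟦X⟧} (hf : PosFrom d f) : PosFrom (d + 1) (X * f) := by
  obtain ⟨f, hf, rfl⟩ := hf
  exact ⟨f, hf, by ring⟩

theorem PosFrom.coeff_pos {d n : ℕ} {f : ℤ⟦X⟧} (hf : PosFrom d f) (hn : d ≤ n) :
    0 < coeff n f := by
  obtain ⟨f, hf, rfl⟩ := hf
  obtain ⟨m, rfl⟩ := Nat.exists_eq_add_of_le' hn
  rw [coeff_X_pow_mul]
  exact hf m

/-! ### Generating function of copies -/

/-- The generating function, by number of nodes, of the copies of `F` in all trees. -/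
noncomputable def copyGF (F : BinaryTree Unit) : ℤ⟦X⟧ :=
  PowerSeries.mk fun n => ∑ G ∈ treesOfNumNodesEq n, (treeCount G F : ℤ)

theorem sum_treesOfNumNodesEq_succ (f : BinaryTree Unit → ℤ) (n : ℕ) :
    ∑ G ∈ treesOfNumNodesEq (n + 1), f G =
      ∑ p ∈ antidiagonal n, ∑ a ∈ treesOfNumNodesEq p.1, ∑ b ∈ treesOfNumNodesEq p.2,
        f (.node () a b) := by
  rw [treesOfNumNodesEq_succ, sum_biUnion]
  · exact sum_congr rfl fun p _ => by rw [sum_map, sum_product]; rfl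
  · simp_rw [Set.PairwiseDisjoint, Set.Pairwise, disjoint_left]
    aesop

/-- The contribution to `copyGF` of the copies using the root. -/
noncomputable def rootGF (f g : BinaryTree Unit → ℤ⟦X⟧) : BinaryTree Unit → ℤ⟦X⟧
  | .nil => 1
  | .node _ a b => X * (f a * g b)

theorem coeff_zero_copyGF (F : BinaryTree Unit) :
    coeff 0 (copyGF F) = if F = .nil then 1 else 0 := by
  simp [copyGF, treeCount]

theorem coeff_succ_copyGF (F : BinaryTree Unit) (n : ℕ) :
    coeff (n + 1) (copyGF F) =
      coeff n ((splits F).map fun p => copyGF p.1 * copyGF p.2).sum +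
      coeff (n + 1) (rootGF copyGF copyGF F) := by
  have key : ∀ F₁ F₂, coeff n (copyGF F₁ * copyGF F₂) = ∑ p ∈ antidiagonal n,
      ∑ a ∈ treesOfNumNodesEq p.1, ∑ b ∈ treesOfNumNodesEq p.2,
        (treeCount a F₁ : ℤ) * treeCount b F₂ := by
    intro F₁ F₂
    rw [coeff_mul]
    exact sum_congr rfl fun p _ => by rw [copyGF, copyGF, coeff_mk, coeff_mk, sum_mul_sum]
  have h1 : ∀ S : List (BinaryTree Unit × BinaryTree Unit),
      coeff n (S.map fun p => copyGF p.1 * copyGF p.2).sum = ∑ p ∈ antidiagonal n,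
      ∑ a ∈ treesOfNumNodesEq p.1, ∑ b ∈ treesOfNumNodesEq p.2,
        (((S.map fun p => treeCount a p.1 * treeCount b p.2).sum : ℕ) : ℤ) := by
    intro S
    induction S with
    | nil => simp
    | cons q S ih =>
      simp only [List.map_cons, List.sum_cons, map_add, ih, key, Nat.cast_add, Nat.cast_mul,
        sum_add_distrib]
  have h2 : coeff (n + 1) (rootGF copyGF copyGF F) = ∑ p ∈ antidiagonal n,
      ∑ a ∈ treesOfNumNodesEq p.1, ∑ b ∈ treesOfNumNodesEq p.2,
        ((treeCountRoot (treeCount a) (treeCount b) F : ℕ) : ℤ) := by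
    cases F with
    | nil => simp [rootGF, treeCountRoot, coeff_one]
    | node u c d => simp only [rootGF, treeCountRoot, coeff_succ_X_mul, key, Nat.cast_mul]
  rw [h1, h2, copyGF, coeff_mk, sum_treesOfNumNodesEq_succ]
  simp only [treeCount, Nat.cast_add, sum_add_distrib]

theorem copyGF_nil : copyGF .nil = X * (copyGF .nil * copyGF .nil) + 1 := by
  ext n
  cases n with
  | zero => simp [coeff_zero_copyGF]
  | succ n => simp [coeff_succ_copyGF, splits, rootGF, coeff_succ_X_mul]

theorem posCoeff_copyGF_nil : PosCoeff (copyGF .nil) := by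
  intro n
  induction n using Nat.strong_induction_on with
  | _ n ih =>
    rw [copyGF_nil]
    cases n with
    | zero => simp
    | succ n =>
      rw [map_add, coeff_succ_X_mul, coeff_mul, coeff_one, if_neg (by simp), add_zero]
      refine sum_pos (fun p hp => ?_) ⟨(0, n), by simp⟩
      have := mem_antidiagonal.1 hp
      exact mul_pos (ih _ (by omega)) (ih _ (by omega))

/-! ### Spine series and their inequality -/

/-- The inverse of `1 - 2 X C`, with `C` the generating function of all trees. -/
noncomputable def centralGF : ℤ⟦X⟧ := invOfUnit (1 - 2 * (X * copyGF .nil)) 1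

theorem centralGF_mul : (1 - 2 * (X * copyGF .nil)) * centralGF = 1 :=
  mul_invOfUnit _ _ (by simp)

theorem posCoeff_centralGF : PosCoeff centralGF := by
  have h : centralGF = X * (2 * (copyGF .nil * centralGF)) + 1 := by
    linear_combination centralGF_mul
  intro n
  induction n using Nat.strong_induction_on with
  | _ n ih =>
    rw [h]
    cases n with
    | zero => simp
    | succ n =>
      rw [map_add, coeff_succ_X_mul, two_mul, map_add, coeff_mul, coeff_one, if_neg (by simp),
        add_zero]
      have : 0 < ∑ p ∈ antidiagonal n, coeff p.1 (copyGF .nil) * coeff p.2 centralGF := by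
        refine sum_pos (fun p hp => ?_) ⟨(0, n), by simp⟩
        have := mem_antidiagonal.1 hp
        exact mul_pos (posCoeff_copyGF_nil _) (ih _ (by omega))
      omega

/-- The generating function of the ways to distribute `m` siblings in a plane forest. -/
noncomputable def spineGF : ℕ → ℤ⟦X⟧
  | 0 => copyGF .nil
  -- The extreme terms of the convolution in `spineGF_succ_eq` contain the unknown itself and are
  -- absorbed by `centralGF`. The remaining indices are at most `m`; `Fin m` provides the bound for
  -- the recursion.
  | m + 1 => centralGF * (X * ∑ i : Fin m, spineGF (i + 1) * spineGF (m - i) + spineGF m)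

theorem spineGF_zero : spineGF 0 = copyGF .nil := by rw [spineGF]

theorem spineGF_succ (m : ℕ) : spineGF (m + 1) =
    centralGF * (X * ∑ i ∈ range m, spineGF (i + 1) * spineGF (m - i) + spineGF m) := by
  rw [spineGF, Fin.sum_univ_eq_sum_range fun i => spineGF (i + 1) * spineGF (m - i)]

theorem posCoeff_spineGF (m : ℕ) : PosCoeff (spineGF m) := by
  induction m using Nat.strong_induction_on with
  | _ m ih =>
    cases m with
    | zero => rw [spineGF_zero]; exact posCoeff_copyGF_nil
    | succ m =>
      rw [spineGF_succ]
      refine posCoeff_centralGF.mul (NonnegCoeff.add_pos (nonnegCoeff_X.mul ?_) (ih m (by omega)))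
      refine NonnegCoeff.sum fun i hi => ?_
      have := mem_range.1 hi
      exact ((ih _ (by omega)).mul (ih _ (by omega))).nonneg

theorem spineGF_succ_eq (m : ℕ) : spineGF (m + 1) =
    X * ∑ p ∈ antidiagonal (m + 1), spineGF p.1 * spineGF p.2 + spineGF m := by
  have h : ∑ p ∈ antidiagonal (m + 1), spineGF p.1 * spineGF p.2 =
      ∑ i ∈ range m, spineGF (i + 1) * spineGF (m - i) + 2 * (copyGF .nil * spineGF (m + 1)) := by
    rw [Nat.sum_antidiagonal_eq_sum_range_succ fun i j => spineGF i * spineGF j, sum_range_succ,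
      sum_range_succ', sum_congr rfl fun i hi => by
        rw [show m + 1 - (i + 1) = m - i by omega]]
    simp only [Nat.sub_zero, Nat.sub_self, spineGF_zero]
    ring
  rw [h]
  have h1 := spineGF_succ m
  have h2 := centralGF_mul
  linear_combination (1 - 2 * (X * copyGF .nil)) * h1 +
    (X * ∑ i ∈ range m, spineGF (i + 1) * spineGF (m - i) + spineGF m) * h2

/-- Expand both `spineGF (m + 1 + r)` and `spineGF (m + 1)` by the recurrence. The first `m`
convolution terms pair off into differences of the same shape with smaller first index; the other
`r` terms are left over with a positive sign. -/
theorem spineGF_mul_sub (m r : ℕ) :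
    spineGF 0 * spineGF (m + 1 + r) - spineGF (m + 1) * spineGF r =
      centralGF * (X * ∑ i ∈ range m, spineGF (i + 1) *
          (spineGF 0 * spineGF (m - i + r) - spineGF (m - i) * spineGF r) +
        (spineGF 0 * spineGF (m + r) - spineGF m * spineGF r) +
        X * ∑ i ∈ range r, spineGF 0 * spineGF (m + i + 1) * spineGF (r - i)) := by
  have h : ∑ i ∈ range (m + r), spineGF (i + 1) * spineGF (m + r - i) =
      ∑ i ∈ range m, spineGF (i + 1) * spineGF (m - i + r) +
        ∑ i ∈ range r, spineGF (m + i + 1) * spineGF (r - i) := by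
    rw [sum_range_add]
    congr 1
    · refine sum_congr rfl fun i hi => ?_
      have := mem_range.1 hi
      rw [show m + r - i = m - i + r by omega]
    · exact sum_congr rfl fun i _ => by rw [show m + r - (m + i) = r - i by omega]
  rw [show m + 1 + r = m + r + 1 by omega, spineGF_succ, spineGF_succ, h]
  simp only [mul_sub, sum_sub_distrib, mul_add, mul_sum, sum_mul, add_mul]
  simp only [mul_left_comm, mul_comm, mul_assoc]
  ring

theorem nonnegCoeff_spineGF_sub (m r : ℕ) :
    NonnegCoeff (spineGF 0 * spineGF (m + r) - spineGF m * spineGF r) := by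
  induction m using Nat.strong_induction_on with
  | _ m ih =>
    cases m with
    | zero => simp [NonnegCoeff]
    | succ m =>
      rw [spineGF_mul_sub]
      refine posCoeff_centralGF.nonneg.mul (((nonnegCoeff_X.mul ?_).add (ih m (by omega))).add
        (nonnegCoeff_X.mul ?_))
      · exact NonnegCoeff.sum fun i hi => (posCoeff_spineGF _).nonneg.mul (ih _ (by omega))
      · exact NonnegCoeff.sum fun i hi => (((posCoeff_spineGF _).mul (posCoeff_spineGF _)).mul
          (posCoeff_spineGF _)).nonneg

theorem NonnegCoeff.posFrom_one {f g : ℤ⟦X⟧} (hf : NonnegCoeff f) (h0 : coeff 0 f = 0)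
    (hg : PosCoeff g) : PosFrom 1 (f + X * g) := by
  have h : f = X * PowerSeries.mk fun n => coeff (n + 1) f := by
    ext n
    cases n with
    | zero => simpa using h0
    | succ n => simp [coeff_succ_X_mul]
  refine ⟨(PowerSeries.mk fun n => coeff (n + 1) f) + g, NonnegCoeff.add_pos (fun n => ?_) hg, ?_⟩
  · simpa using hf (n + 1)
  · rw [pow_one, mul_add, ← h]

theorem coeff_zero_spineGF (m : ℕ) : coeff 0 (spineGF m) = 1 := by
  induction m with
  | zero => simp [spineGF_zero, coeff_zero_copyGF]
  | succ m ih => rw [spineGF_succ_eq, map_add, ih]; simp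

theorem posFrom_spineGF_sub (m r : ℕ) :
    PosFrom 1 (spineGF 0 * spineGF (m + 1 + (r + 1)) - spineGF (m + 1) * spineGF (r + 1)) := by
  obtain ⟨f, hf, h⟩ : ∃ f, NonnegCoeff f ∧
      spineGF 0 * spineGF (m + 1 + (r + 1)) - spineGF (m + 1) * spineGF (r + 1) =
        f + X * (centralGF * (spineGF 0 * spineGF (m + 1) * spineGF (r + 1))) := by
    -- The term `i = 0` of the leftover sum is the source of strictness.
    rw [spineGF_mul_sub, sum_range_succ']
    refine ⟨_, ?_, by rw [mul_add X, ← add_assoc, mul_add centralGF, mul_left_comm centralGF X];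
                      rfl⟩
    refine posCoeff_centralGF.nonneg.mul (((nonnegCoeff_X.mul ?_).add
      (nonnegCoeff_spineGF_sub _ _)).add (nonnegCoeff_X.mul ?_))
    · exact NonnegCoeff.sum fun i hi => (posCoeff_spineGF _).nonneg.mul
        (nonnegCoeff_spineGF_sub _ _)
    · exact NonnegCoeff.sum fun i hi => (((posCoeff_spineGF _).mul (posCoeff_spineGF _)).mul
        (posCoeff_spineGF _)).nonneg
  rw [h]
  refine hf.posFrom_one ?_ (posCoeff_centralGF.mul (((posCoeff_spineGF _).mul
    (posCoeff_spineGF _)).mul (posCoeff_spineGF _)))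
  -- All spine series have constant term 1, so the difference, and with it `f`, has constant term 0.
  have := congrArg (coeff 0) h
  have h0 := fun m => (coeff_zero_eq_constantCoeff_apply (spineGF m)).symm.trans
    (coeff_zero_spineGF m)
  simpa [h0] using this.symm

/-! ### Product formula -/

/-- The number of nodes on the right spine. -/
def spineLength : BinaryTree Unit → ℕ
  | .nil => 0
  | .node _ _ b => spineLength b + 1

/-- The product over all nodes of the generating functions of their left subtrees' spines. -/
noncomputable def nodeGF : BinaryTree Unit → ℤ⟦X⟧
  | .nil => 1
  | .node _ a b => X * (spineGF (spineLength a) * nodeGF a * nodeGF b)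

theorem sum_splits (g : ℕ → ℕ → ℤ⟦X⟧) (F : BinaryTree Unit) :
    ((splits F).map fun p => g (spineLength p.1) (spineLength p.2)).sum =
      ∑ p ∈ antidiagonal (spineLength F), g p.1 p.2 := by
  induction F generalizing g with
  | nil => simp [splits, spineLength]
  | node u a b iha ihb =>
    rw [splits, spineLength, Nat.antidiagonal_succ, sum_cons, sum_map, List.map_cons,
      List.map_map, List.sum_cons]
    exact congrArg _ (ihb fun i j => g (i + 1) j)

/-- Cutting the right spine leaves every left subtree intact. -/
theorem nodeGF_of_mem_splits {F : BinaryTree Unit} {p : BinaryTree Unit × BinaryTree Unit}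
    (hp : p ∈ splits F) : nodeGF p.1 * nodeGF p.2 = nodeGF F := by
  induction F generalizing p with
  | nil => simp_all [splits, nodeGF]
  | node u a b iha ihb =>
    simp only [splits, List.mem_cons, List.mem_map] at hp
    rcases hp with rfl | ⟨q, hq, rfl⟩
    · simp [nodeGF]
    · simp only [nodeGF, ← ihb hq]
      ring

/-- The product formula for `copyGF`; see `copyGF_eq`. -/
noncomputable def prodGF (F : BinaryTree Unit) : ℤ⟦X⟧ := spineGF (spineLength F) * nodeGF F

theorem prodGF_eq (F : BinaryTree Unit) :
    prodGF F = X * ((splits F).map fun p => prodGF p.1 * prodGF p.2).sum +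
      rootGF prodGF prodGF F := by
  have h : ((splits F).map fun p => prodGF p.1 * prodGF p.2).sum =
      (∑ p ∈ antidiagonal (spineLength F), spineGF p.1 * spineGF p.2) * nodeGF F := by
    rw [← sum_splits fun i j => spineGF i * spineGF j, ← List.sum_map_mul_right]
    refine congrArg List.sum (List.map_congr_left fun p hp => ?_)
    rw [← nodeGF_of_mem_splits hp, prodGF, prodGF]
    ring
  rw [h]
  cases F with
  | nil =>
    simp only [prodGF, spineLength, nodeGF, rootGF, HasAntidiagonal.antidiagonal_zero, sum_singleton, mul_one,
      spineGF_zero]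
    exact copyGF_nil
  | node u a b =>
    simp only [prodGF, spineLength, rootGF, spineGF_succ_eq (spineLength b), nodeGF]
    ring

/-- Both series satisfy the same recurrence, whose right side involves only coefficients of lower
degree, apart from the constant 1 for the empty tree. -/
theorem copyGF_eq (F : BinaryTree Unit) : copyGF F = prodGF F := by
  ext n
  induction n using Nat.strong_induction_on generalizing F with
  | _ n ih =>
    have key : ∀ m < n, ∀ F G, coeff m (copyGF F * copyGF G) = coeff m (prodGF F * prodGF G) := by
      intro m hm F G
      rw [coeff_mul, coeff_mul]
      refine sum_congr rfl fun p hp => ?_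
      have := mem_antidiagonal.1 hp
      rw [ih _ (by omega), ih _ (by omega)]
    rw [prodGF_eq]
    cases n with
    | zero => cases F <;> simp [coeff_zero_copyGF, rootGF]
    | succ n =>
      rw [coeff_succ_copyGF, map_add, coeff_succ_X_mul]
      congr 1
      · induction splits F with
        | nil => simp
        | cons p S ihS =>
          simp only [List.map_cons, List.sum_cons, map_add, ihS, key n n.lt_succ_self]
      · cases F with
        | nil => rfl
        | node u a b => simp only [rootGF, coeff_succ_X_mul, key n n.lt_succ_self]

theorem nonnegFrom_nodeGF (F : BinaryTree Unit) : NonnegFrom F.numNodes (nodeGF F) := by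
  induction F with
  | nil =>
    refine ⟨1, ⟨fun n => ?_, by simp⟩, by simp [nodeGF]⟩
    rw [coeff_one]
    split_ifs <;> simp
  | node u a b iha ihb =>
    simpa [nodeGF] using ((((posCoeff_spineGF (spineLength a)).nonnegFrom.mul iha).mul ihb).X_mul)

/-! ### Moves on trees -/

/-- Moving a node with nonempty left subtree in front of that subtree. -/
inductive Move : BinaryTree Unit → BinaryTree Unit → Prop
  | head {a b : BinaryTree Unit} (ha : a ≠ .nil) : Move (.node () a b) (.node () .nil (join a b))
  | left {a a' b : BinaryTree Unit} (h : Move a a') : Move (.node () a b) (.node () a' b)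
  | right {a b b' : BinaryTree Unit} (h : Move b b') : Move (.node () a b) (.node () a b')

theorem spineLength_join (F G : BinaryTree Unit) :
    spineLength (join F G) = spineLength F + spineLength G := by
  induction F with
  | nil => simp [join, spineLength]
  | node u a b iha ihb => simp only [join, spineLength, ihb]; omega

theorem nodeGF_join (F G : BinaryTree Unit) : nodeGF (join F G) = nodeGF F * nodeGF G := by
  induction F with
  | nil => simp [join, nodeGF]
  | node u a b iha ihb => simp only [join, nodeGF, ihb]; ring

/-- A move strictly increases the coefficients from the first nontrivial degree on, also after
adding `r` nodes to the right spine. -/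
theorem Move.posFrom {F F' : BinaryTree Unit} (h : Move F F') (r : ℕ) :
    PosFrom (F.numNodes + 1) (spineGF (spineLength F' + r) * nodeGF F' -
      spineGF (spineLength F + r) * nodeGF F) := by
  induction h generalizing r with
  | @head a b ha =>
    cases a with
    | nil => exact absurd rfl ha
    | node u c d =>
      have := ((posFrom_spineGF_sub (spineLength d) (spineLength b + r)).mul
        ((nonnegFrom_nodeGF (.node u c d)).mul (nonnegFrom_nodeGF b))).X_mul
      convert this using 1
      · simp only [numNodes]; omega
      · rw [nodeGF, nodeGF.eq_def (.node () (.node u c d) b), nodeGF_join]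
        simp only [spineLength, spineLength_join, nodeGF.eq_1]
        rw [show spineLength d + 1 + spineLength b + 1 + r =
            spineLength d + 1 + (spineLength b + r + 1) by omega,
          show spineLength b + 1 + r = spineLength b + r + 1 by omega]
        ring
  | @left a a' b _ ih =>
    -- The spine of the left subtree ends inside it, so nothing is added; the outer spine is a
    -- common factor.
    have := (((ih 0).mul (nonnegFrom_nodeGF b)).mul
      (posCoeff_spineGF (spineLength b + 1 + r)).nonnegFrom).X_mul
    convert this using 1
    · simp only [numNodes]; omega
    · simp only [nodeGF, spineLength, add_zero]
      ring
  | @right a b b' _ ih =>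
    -- The root lies on the same spine as the right subtree and counts as one more added node.
    have := ((ih (1 + r)).mul ((posCoeff_spineGF (spineLength a)).nonnegFrom.mul
      (nonnegFrom_nodeGF a))).X_mul
    convert this using 1
    · simp only [numNodes]; omega
    · simp only [nodeGF, spineLength, add_assoc]
      ring

theorem Move.coeff_copyGF_lt {F F' : BinaryTree Unit} (h : Move F F') {n : ℕ}
    (hn : F.numNodes < n) : coeff n (copyGF F) < coeff n (copyGF F') := by
  have := (h.posFrom 0).coeff_pos hn
  rw [copyGF_eq, copyGF_eq, prodGF, prodGF]
  simpa using this

theorem IsWord.exists_move {α : Type*} [LinearOrder α] {F : BinaryTree Unit}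
    {x y : α} {l₁ l₂ l₃ : List α} (h : IsWord F (l₁ ++ x :: l₂ ++ y :: l₃)) (hxy : x < y)
    (hl : ∀ a ∈ l₁, y < a) :
    ∃ F', Move F F' ∧ IsWord F' (l₁ ++ y :: x :: l₂ ++ l₃) := by
  induction F generalizing l₁ l₂ l₃ with
  | nil => simp [IsWord] at h
  | node u a b iha ihb =>
    obtain ⟨q, M, t, he, ha, hb, hq, ht, hqt⟩ := h
    -- If `y` is the maximum, `l₁` must be empty and the move takes place at the root.
    have hhead : q = l₁ ++ x :: l₂ → M = y → t = l₃ → ∃ F', Move (.node u a b) F' ∧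
        IsWord F' (l₁ ++ y :: x :: l₂ ++ l₃) := by
      rintro rfl rfl rfl
      obtain rfl : l₁ = [] := List.eq_nil_iff_forall_not_mem.2 fun c hc =>
        (hl c hc).not_gt (hq c (by simp [hc]))
      refine ⟨_, .head ?_, [], M, x :: l₂ ++ t, by simp, rfl, ha.join hb hqt, by simp, ?_, by simp⟩
      · rintro rfl
        simp [IsWord] at ha
      · intro c hc
        rcases List.mem_append.1 hc with hc | hc
        · exact hq c hc
        · exact ht c hc
    rcases List.append_eq_append_iff.1 he with ⟨e, rfl, h⟩ | ⟨e, h', h⟩ <;> cases e with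
    | nil =>
      simp only [List.nil_append, List.append_nil, List.cons.injEq] at *
      grind
    | cons c e => ?_
    · simp only [List.cons_append, List.cons.injEq] at h
      obtain ⟨rfl, rfl⟩ := h
      obtain ⟨a', hm, hw⟩ := iha ha hl
      refine ⟨_, .left hm, l₁ ++ y :: x :: l₂ ++ e, M, t, by simp, hw, hb, ?_, ht, ?_⟩
      · intro c hc; exact hq c (by simp at hc ⊢; tauto)
      · intro c hc; exact hqt c (by simp at hc ⊢; tauto)
    · simp only [List.cons_append, List.cons.injEq] at h
      obtain ⟨rfl, rfl⟩ := h
      have hyM : y < M := ht y (by simp)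
      -- The maximum precedes `y`. It cannot be `x`, nor lie between `x` and `y`, since then `y <
      -- x`; so it lies in `l₁` and the move is in the right subtree.
      rcases List.append_eq_append_iff.1 h' with ⟨f, rfl, h⟩ | ⟨f, rfl, h⟩ <;> cases f with
      | nil =>
        simp only [List.nil_append, List.cons.injEq] at h
        exact absurd (h.1 ▸ hxy) hyM.not_gt
      | cons c f => ?_
      · simp only [List.cons_append, List.cons.injEq] at h
        obtain ⟨rfl, rfl⟩ := h
        exact absurd hxy (hqt x (by simp) y (by simp)).not_gt
      · simp only [List.cons_append, List.cons.injEq] at h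
        obtain ⟨rfl, rfl⟩ := h
        obtain ⟨b', hm, hw⟩ := ihb hb fun c hc => hl c (by simp [hc])
        refine ⟨_, .right hm, q, M, f ++ y :: x :: l₂ ++ l₃, by simp, ha, hw, hq, ?_, ?_⟩
        · intro c hc; exact ht c (by simp at hc ⊢; tauto)
        · intro d hd c hc; exact hqt d hd c (by simp at hc ⊢; tauto)

end PatternPopularity

/-! ### From permutations to trees -/

namespace PatternPopularity

open BinaryTree PowerSeries Finset

theorem avoids132_iff_listAvoids {n : ℕ} (σ : Equiv.Perm (Fin n)) :
    Avoids132 σ ↔ ListAvoids (List.ofFn σ) := by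
  rw [ListAvoids, List.triplewise_iff_getElem, Avoids132, Contains]
  constructor
  · intro h i j k hij hjk hk hσ
    simp only [List.length_ofFn] at hk
    simp only [List.getElem_ofFn] at hσ
    have hmono : StrictMono ![(⟨i, by omega⟩ : Fin n), ⟨j, by omega⟩, ⟨k, hk⟩] := by
      intro s t hst
      fin_cases s <;> fin_cases t <;> simp_all; omega
    refine h ⟨OrderEmbedding.ofStrictMono _ hmono, fun s t => ?_⟩
    have h1 := hσ.1
    have h2 := hσ.2
    have h3 := h1.trans h2
    fin_cases s <;> fin_cases t <;>
      simp [pattern132, h1.le, h2.le, h3.le, h1, h2, h3, Equiv.swap_apply_def]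
  · rintro h ⟨e, he⟩
    have h01 : e 0 < e 1 := e.strictMono (by decide)
    have h12 : e 1 < e 2 := e.strictMono (by decide)
    refine h (e 0) (e 1) (e 2) h01 h12 (by simp) ?_
    simp only [List.getElem_ofFn, Fin.eta]
    constructor
    · exact not_le.1 fun hle => absurd ((he 2 0).1 hle) (by decide)
    · exact not_le.1 fun hle => absurd ((he 1 2).1 hle) (by decide)

theorem isOccurrence_iff_isWord {n k : ℕ} (σ : Equiv.Perm (Fin n)) {τ : Equiv.Perm (Fin k)}
    {F : BinaryTree Unit} (hF : IsWord F (List.ofFn τ)) (e : Fin k ↪o Fin n) :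
    IsOccurrence σ τ e ↔ IsWord F (List.ofFn fun s => σ (e s)) := by
  have h1 : (List.ofFn fun s => (τ s, σ (e s))).map Prod.fst = List.ofFn τ := by
    rw [List.map_ofFn]; rfl
  have h2 : (List.ofFn fun s => (τ s, σ (e s))).map Prod.snd = List.ofFn fun s => σ (e s) := by
    rw [List.map_ofFn]; rfl
  constructor
  · intro h
    rw [← h2]
    rw [← h1] at hF
    refine hF.of_sameOrder (List.pairwise_ofFn.2 fun s t _ => ⟨?_, ?_⟩)
    · exact lt_iff_lt_of_le_iff_le (h t s).symm
    · exact lt_iff_lt_of_le_iff_le (h s t).symm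
  · intro h
    have := List.pairwise_ofFn.1 (IsWord.sameOrder (h1 ▸ hF) (h2 ▸ h))
    intro s t
    rcases lt_trichotomy s t with hst | rfl | hst
    · exact (le_iff_le_iff_lt_iff_lt.2 (this hst).2).symm
    · simp
    · exact (le_iff_le_iff_lt_iff_lt.2 (this hst).1).symm

theorem ofFn_orderEmbedding_sublist {α : Type*} {n k : ℕ} (f : Fin n → α) (e : Fin k ↪o Fin n) :
    (List.ofFn fun s => f (e s)).Sublist (List.ofFn f) := by
  refine List.sublist_iff_exists_fin_orderEmbedding_get_eq.2
    ⟨((Fin.castOrderIso List.length_ofFn).toOrderEmbedding.trans e).trans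
      (Fin.castOrderIso List.length_ofFn.symm).toOrderEmbedding, fun s => ?_⟩
  simp [Fin.cast]

theorem exists_orderEmbedding_of_sublist_ofFn {α : Type*} {n : ℕ} {f : Fin n → α} {x : List α}
    (h : x.Sublist (List.ofFn f)) :
    ∃ e : Fin x.length ↪o Fin n, x = List.ofFn fun s => f (e s) := by
  obtain ⟨g, hg⟩ := List.sublist_iff_exists_fin_orderEmbedding_get_eq.1 h
  refine ⟨g.trans (Fin.castOrderIso List.length_ofFn).toOrderEmbedding, ?_⟩
  refine List.ext_getElem (by simp) fun s hs hs' => ?_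
  simpa [Fin.cast] using hg ⟨s, hs⟩

theorem copies_eq_countWords {n k : ℕ} (σ : Equiv.Perm (Fin n)) {τ : Equiv.Perm (Fin k)}
    {F : BinaryTree Unit} (hF : IsWord F (List.ofFn τ)) :
    copies σ τ = countWords F (List.ofFn σ) := by
  classical
  have hnd : (List.ofFn σ).Nodup := List.nodup_ofFn.2 σ.injective
  have h1 : countWords F (List.ofFn σ) =
      #{x ∈ (List.ofFn σ).sublists.toFinset | IsWord F x} := by
    rw [card_filter, List.sum_toFinset _ (List.nodup_sublists.2 hnd)]
    rfl
  rw [h1, copies, ← Nat.card_eq_finsetCard]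
  have hmem : ∀ e : {e : Fin k ↪o Fin n // IsOccurrence σ τ e}, (List.ofFn fun s => σ (e.1 s)) ∈
      {x ∈ (List.ofFn σ).sublists.toFinset | IsWord F x} := by
    rintro ⟨e, he⟩
    rw [mem_filter, List.mem_toFinset, List.mem_sublists]
    refine ⟨ofFn_orderEmbedding_sublist σ e, (isOccurrence_iff_isWord σ hF e).1 he⟩
  refine Nat.card_eq_of_bijective (fun e => ⟨_, hmem e⟩) ⟨fun e e' h => ?_, ?_⟩
  · have := List.ofFn_injective (congrArg Subtype.val h)
    exact Subtype.ext (DFunLike.ext _ _ fun s => σ.injective (congrFun this s))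
  · rintro ⟨x, hx⟩
    rw [mem_filter, List.mem_toFinset, List.mem_sublists] at hx
    obtain rfl : k = x.length := by rw [hx.2.length_eq, ← hF.length_eq, List.length_ofFn]
    obtain ⟨e, he⟩ := exists_orderEmbedding_of_sublist_ofFn hx.1
    refine ⟨⟨e, (isOccurrence_iff_isWord σ hF e).2 (he ▸ hx.2)⟩, Subtype.ext he.symm⟩

/-- Equal trees mean equal relative order, so `σ.symm.trans σ'` is an order automorphism of `Fin n`,
hence the identity. -/
theorem isWord_perm_unique {n : ℕ} {σ σ' : Equiv.Perm (Fin n)} {G : BinaryTree Unit}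
    (h : IsWord G (List.ofFn σ)) (h' : IsWord G (List.ofFn σ')) : σ = σ' := by
  have h1 := (isOccurrence_iff_isWord σ' h (RelEmbedding.refl _)).2 h'
  let f : Fin n ≃o Fin n := ⟨σ.symm.trans σ', fun {a b} => by
    simpa using h1 (σ.symm a) (σ.symm b)⟩
  ext s
  have : f (σ s) = σ s := by rw [Subsingleton.elim f (OrderIso.refl _)]; rfl
  simpa [f] using congrArg Fin.val this.symm

/-- The standard `132`-avoiding word with a given tree. -/
def treeWord : BinaryTree Unit → List ℕ
  | .nil => []
  | .node _ a b =>
      (treeWord a).map (· + b.numNodes) ++ (a.numNodes + b.numNodes) :: treeWord b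

theorem lt_of_mem_treeWord {G : BinaryTree Unit} {x : ℕ} (hx : x ∈ treeWord G) :
    x < G.numNodes := by
  induction G generalizing x with
  | nil => simp [treeWord] at hx
  | node u a b iha ihb =>
    simp only [treeWord, List.mem_append, List.mem_map, List.mem_cons] at hx
    rw [numNodes]
    rcases hx with ⟨y, hy, rfl⟩ | rfl | hx
    · have := iha hy; omega
    · omega
    · have := ihb hx; omega

theorem IsWord.map {α β : Type*} [LinearOrder α] [LinearOrder β] {G : BinaryTree Unit}
    {l : List α} {f : α → β} (hf : StrictMono f) (h : IsWord G l) : IsWord G (l.map f) := by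
  have := IsWord.of_sameOrder (z := l.map fun a => (a, f a)) (F := G) ?_
    (by simpa [Function.comp_def] using h)
  · simpa [Function.comp_def] using this
  · exact List.pairwise_map.2 (List.pairwise_of_forall_mem_list fun a _ b _ =>
      ⟨hf.lt_iff_lt.symm, hf.lt_iff_lt.symm⟩)

theorem isWord_treeWord (G : BinaryTree Unit) : IsWord G (treeWord G) := by
  induction G with
  | nil => rfl
  | node u a b iha ihb =>
    refine ⟨_, _, _, rfl, iha.map fun x y h => Nat.add_lt_add_right h _, ihb, ?_, ?_, ?_⟩
    · simp only [List.forall_mem_map]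
      exact fun x hx => Nat.add_lt_add_right (lt_of_mem_treeWord hx) _
    · exact fun y hy => (lt_of_mem_treeWord hy).trans_le (Nat.le_add_left _ _)
    · simp only [List.forall_mem_map]
      exact fun x _ y hy => (lt_of_mem_treeWord hy).trans_le (Nat.le_add_left _ _)

theorem exists_perm_isWord {n : ℕ} {G : BinaryTree Unit} (hG : G.numNodes = n) :
    ∃ σ : Equiv.Perm (Fin n), IsWord G (List.ofFn σ) := by
  have hlen : (treeWord G).length = n := (isWord_treeWord G).length_eq.trans hG
  let f : Fin n → Fin n := fun i => ⟨(treeWord G)[i],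
    hG ▸ lt_of_mem_treeWord (List.getElem_mem _)⟩
  have hf : f.Injective := by
    intro i j hij
    have := (isWord_treeWord G).nodup.getElem_inj_iff.1 (congrArg Fin.val hij)
    exact Fin.ext this
  refine ⟨Equiv.ofBijective f (Finite.injective_iff_bijective.1 hf), ?_⟩
  have h1 : (List.ofFn fun i => ((f i : ℕ), f i)).map Prod.fst = treeWord G := by
    rw [List.map_ofFn]
    exact List.ext_getElem (by simp [hlen]) fun i _ _ => by simp [f]
  have h2 : (List.ofFn fun i => ((f i : ℕ), f i)).map Prod.snd = List.ofFn f := by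
    rw [List.map_ofFn]; rfl
  have h3 := isWord_treeWord G
  rw [← h1] at h3
  have := h3.of_sameOrder (List.pairwise_ofFn.2 fun i j _ => ⟨Iff.rfl, Iff.rfl⟩)
  rwa [h2] at this

theorem popularity_eq_coeff {n k : ℕ} {τ : Equiv.Perm (Fin k)} {F : BinaryTree Unit}
    (hF : IsWord F (List.ofFn τ)) : (popularity n τ : ℤ) = coeff n (copyGF F) := by
  classical
  have hex : ∀ σ : Equiv.Perm (Fin n), Avoids132 σ → ∃ G, IsWord G (List.ofFn σ) := fun σ hσ =>
    ((avoids132_iff_listAvoids σ).1 hσ).exists_isWord (List.nodup_ofFn.2 σ.injective)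
  choose g hg using hex
  rw [copyGF, coeff_mk, ← Nat.cast_sum, popularity]
  congr 1
  refine sum_bij (fun σ hσ => g σ (mem_filter.1 hσ).2) ?_ ?_ ?_ ?_
  · intro σ hσ
    rw [mem_treesOfNumNodesEq, ← (hg σ _).length_eq, List.length_ofFn]
  · intro σ hσ σ' hσ' h
    exact isWord_perm_unique (hg σ _) (h ▸ hg σ' _)
  · intro G hG
    obtain ⟨σ, hσ⟩ := exists_perm_isWord (mem_treesOfNumNodesEq.1 hG)
    have h := (avoids132_iff_listAvoids σ).2 hσ.listAvoids
    exact ⟨σ, by simpa using h, (hg σ h).tree_unique hσ⟩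
  · intro σ hσ
    rw [copies_eq_countWords σ hF, countWords_eq_treeCount (hg σ _)]

theorem IsMoved.exists_lists {k : ℕ} {τ μ : Equiv.Perm (Fin k)} {i j : Fin k} (hij : i < j)
    (h : IsMoved τ i j μ) : ∃ l₁ l₂ l₃ : List (Fin k), (∀ a ∈ l₁, ∃ s < i, a = τ s) ∧
      List.ofFn τ = l₁ ++ τ i :: l₂ ++ τ j :: l₃ ∧
      List.ofFn μ = l₁ ++ τ j :: τ i :: l₂ ++ l₃ := by
  have hij' : (i : ℕ) < j := hij
  have hj := j.isLt
  refine ⟨(List.ofFn τ).take i, ((List.ofFn τ).drop (i + 1)).take (j - i - 1),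
    (List.ofFn τ).drop (j + 1), ?_, ?_, ?_⟩
  · intro a ha
    obtain ⟨s, hs, rfl⟩ := List.mem_take_iff_getElem.1 ha
    simp only [List.length_ofFn, lt_min_iff] at hs
    exact ⟨⟨s, hs.2⟩, hs.1, by simp⟩
  · refine List.ext_getElem ?_ fun s hs hs' => ?_
    · simp; omega
    · simp only [List.length_ofFn] at hs
      simp only [List.getElem_append, List.getElem_cons, List.getElem_take, List.getElem_drop,
        List.getElem_ofFn, List.length_append, List.length_take, List.length_drop,
        List.length_ofFn, List.length_cons]
      split_ifs <;> congr 1 <;> ext <;> simp <;> omega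
  · refine List.ext_getElem ?_ fun s hs hs' => ?_
    · simp; omega
    · simp only [List.length_ofFn] at hs
      -- One formula for `μ` at every position; the truncated `s - 1` is reached only when `i < s`.
      have key : ∀ s : Fin k, μ s = if s < i then τ s else if s = i then τ j else
          if s ≤ j then τ ⟨s - 1, by omega⟩ else τ s := by
        intro s
        split_ifs with h1 h2 h3
        · exact h.before s h1
        · rw [h2, h.at_i]
        · have h1' : (i : ℕ) ≤ s := not_lt.1 h1
          have h2' : (s : ℕ) ≠ i := fun e => h2 (Fin.ext e)
          refine h.shifted _ s ?_ h3 ?_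
          · rw [Fin.le_def]; simp; omega
          · simp; omega
        · exact h.after s (not_le.1 h3)
      simp only [List.getElem_append, List.getElem_cons, List.getElem_take, List.getElem_drop,
        List.getElem_ofFn, List.length_append, List.length_take, List.length_drop,
        List.length_ofFn, List.length_cons, key, Fin.lt_def, Fin.le_def, Fin.ext_iff]
      split_ifs <;> first
        | rfl
        | omega
        | (refine congrArg (fun s => (τ s : ℕ)) (Fin.ext ?_); simp only; omega)

end PatternPopularity

theorem mainTheorem3 {k : ℕ} (τ μ : Equiv.Perm (Fin k)) (j : Fin k)
    (hτ : PatternPopularity.Avoids132 τ) (hμ : PatternPopularity.IsPower τ j μ)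
    (n : ℕ) (hn : k < n) :
    PatternPopularity.popularity n τ < PatternPopularity.popularity n μ := by
  obtain ⟨i, hm, hmv⟩ := hμ
  obtain ⟨F, hF⟩ := ((PatternPopularity.avoids132_iff_listAvoids τ).1 hτ).exists_isWord
    (List.nodup_ofFn.2 τ.injective)
  obtain ⟨l₁, l₂, l₃, hl, h1, h2⟩ := hmv.exists_lists hm.lt
  obtain ⟨F', hmove, hF'⟩ := (h1 ▸ hF).exists_move hm.val_lt fun a ha => by
    obtain ⟨s, hs, rfl⟩ := hl a ha
    exact hm.left s hs
  rw [← h2] at hF'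
  have hsize : F.numNodes = k := by rw [← hF.length_eq, List.length_ofFn]
  have := hmove.coeff_copyGF_lt (n := n) (by omega)
  rw [← PatternPopularity.popularity_eq_coeff hF, ← PatternPopularity.popularity_eq_coeff hF'] at this
  exact_mod_cast this
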